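/- **Cramér–Rao lower bound for delay estimation with a cognitive radar.** Let $N_b\ge 1$, let $0<w<T_s$, $\mathcal N_0>0$ and $B_1,\dots,B_{N_b}>0$. For $1\le i\le N_b$ let $\tilde h_i:\mathbb R\to\mathbb R$ be a known subband pulse that is twice continuously differentiable, vanishes outside $[0,w]$ and is not identically zero. The subbands of the received signal with unknown delay $\tau_0\in[0,T_s-w]$ are $$x_i(t)=\tilde h_i(t-\tau_0)+\eta_i(t),\qquad 0\le t\le T_s,\quad 1\le i\le N_b,$$ where $\eta_1,\dots,\eta_{N_b}$ are independent and $\eta_i$ is white Gaussian noise of variance $\sigma_i^2=\mathcal N_0B_i$, in the sense that the integrals $\eta_i(f)=\int_0^{T_s}f\eta_i$, $f\in L^2[0,T_s]$, form a centred Gaussian process with $E[\eta_i(f)\eta_i(g)]=\sigma_i^2\int_0^{T_s}fg$. (Thus $\sigma_i^2$ is the noise level per orthonormal coefficient, and the log-likelihood of the delay $\theta$ is $\mathcal L(\theta)=c-\sum_i\frac1{2\sigma_i^2}\int_0^{T_s}|x_i(t)-\tilde h_i(t-\theta)|^2\,dt$ in the usual formal notation, where the infinite term $\int x_i^2$, which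 does not depend on $\theta$, is absorbed into $c$.) The data are all the integrals $x_i(f)=\int_0^{T_s}fx_i$. Put $$\mathrm{SNR}_i=\frac{P_i}{\sigma_i^2},\qquad P_i=\int_{\mathbb R}\Big|\int_{\mathbb R}\tilde h_i(t)e^{-2\pi \mathrm{i} ft}\,dt\Big|^2df,\qquad \overline{F_i}=\sqrt{\frac{\int_0^{T_s}[\tilde h_i'(t)]^2\,dt}{\int_0^{T_s}\tilde h_i(t)^2\,dt}} .$$ Let the Fisher information of the data at $\tau_0$ be $I(\tau_0)=-E_{\tau_0}[\partial_\theta^2\mathcal L]=E_{\tau_0}[(\partial_\theta\mathcal L)^2]$ at $\theta=\tau_0$, where $\mathcal L(\theta)$ is the logarithm of the likelihood ratio of the law of the data under delay $\theta$ with respect to the law under delay $\tau_0$, and the derivatives exist in mean square under the latter (in this definition $\theta$ runs over a neighbourhood of $\tau_0$ in $\mathbb R$). Then this Fisher information exists and is positive, and the Cramér–Rao lower bound, its reciprocal, is $$\mathrm{CRLB}_{CR}(\hat\tau_0)=\frac1{I(\tau_0)}=\frac{1}{\sum_{i=1}^{N_b}\mathrm{SNR}_i\cdot\overline{F_i}^{\,2}}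 .$$ Moreover every estimator $\hat\tau_0$ (a measurable function of the data) that is unbiased for all delays in $[0,T_s-w]$ has variance at least $\mathrm{CRLB}_{CR}(\hat\tau_0)$ when the delay is $\tau_0$. -/

import Mathlib

open MeasureTheory ProbabilityTheory Filter Topology
open scoped ENNReal NNReal FourierTransform RealInnerProductSpace

noncomputable section

/-! ### Fisher information and the Cramér–Rao lower bound of a one-parameter family -/

section Fisher

variable {X : Type*} [MeasurableSpace X]

/-- `d` is the derivative at `θ` of the random function `ℓ`, in mean square under `ν`. -/
def HasMeanSquareDeriv (ν : Measure X) (ℓ : ℝ → X → ℝ) (θ : ℝ) (d : X → ℝ) : Prop :=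
  MemLp d 2 ν ∧
    Tendsto (fun u : ℝ => eLpNorm (fun x => u⁻¹ * (ℓ (θ + u) x - ℓ θ x) - d x) 2 ν)
      (𝓝[≠] 0) (𝓝 0)

/-- `J` is the Fisher information at `θ₀` of the family of laws `P`. The log-likelihood function is
`ℓ θ = log (dP θ / dP θ₀)` (a fixed reference measure only changes it by a term that does not
depend on `θ`), `s θ` is its first and `s₂` its second derivative (the latter at `θ₀`), and
`J = -E[∂²ℓ/∂θ²] = E[(∂ℓ/∂θ)²]` under `P θ₀`. As likelihood ratios are only defined up to null sets,
the derivatives are taken in mean square. -/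
def HasFisherInformation (P : ℝ → Measure X) (θ₀ J : ℝ) : Prop :=
  (∀ᶠ θ in 𝓝 θ₀, P θ ≪ P θ₀ ∧ P θ₀ ≪ P θ) ∧
  ∃ (s : ℝ → X → ℝ) (s₂ : X → ℝ),
    (∀ᶠ θ in 𝓝 θ₀, HasMeanSquareDeriv (P θ₀) (fun θ' => llr (P θ') (P θ₀)) θ (s θ)) ∧
    HasMeanSquareDeriv (P θ₀) s θ₀ s₂ ∧
    J = -∫ x, s₂ x ∂(P θ₀) ∧
    J = ∫ x, (s θ₀ x) ^ 2 ∂(P θ₀)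

/-- `b` is the Cramér–Rao lower bound at `θ₀`: the reciprocal of a positive Fisher information. -/
def IsCramerRaoLowerBound (P : ℝ → Measure X) (θ₀ b : ℝ) : Prop :=
  ∃ J : ℝ, 0 < J ∧ HasFisherInformation P θ₀ J ∧ b = 1 / J

/-- `est` is an unbiased estimator of the parameter over the parameter set `Θ`. -/
def IsUnbiasedEstimator (P : ℝ → Measure X) (Θ : Set ℝ) (est : X → ℝ) : Prop :=
  Measurable est ∧ ∀ θ ∈ Θ, Integrable est (P θ) ∧ ∫ x, est x ∂(P θ) = θ

end Fisher

namespace CognitiveRadar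

/-- Real square-integrable test functions on the observation interval `[0, Ts]`. -/
abbrev TestFn (Ts : ℝ) : Type := Lp ℝ 2 (volume.restrict (Set.Icc (0 : ℝ) Ts))

/-- `W` is white Gaussian noise of variance `v` on `[0, Ts]`, given through its integrals
`W f = ∫₀^Ts f(t) η(t) dt` against test functions: a centred Gaussian process with
`E[W f · W g] = v ∫₀^Ts f g`, so that its coefficients along any orthonormal system
are independent with law `N(0, v)`. -/
structure IsWhiteGaussianNoise {Ω : Type*} [MeasurableSpace Ω] (μ : Measure Ω) (Ts v : ℝ)
    (W : TestFn Ts → Ω → ℝ) : Prop where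
  measurable : ∀ f, Measurable (W f)
  gaussian : IsGaussianProcess W μ
  mean_zero : ∀ f, ∫ ω, W f ω ∂μ = 0
  covariance : ∀ f g, ∫ ω, W f ω * W g ω ∂μ = v * ⟪f, g⟫

/-- The observed data: for every subband `i` and every test function `f`,
the integral of `f` against the record of the `i`-th subband. -/
abbrev Data (N : ℕ) (Ts : ℝ) : Type := Fin N → TestFn Ts → ℝ

/-- The received multiband signal `x i t = h i (t - θ) + η i t`, `0 ≤ t ≤ Ts`, `i < N`,
integrated against test functions. -/
def received {Ω : Type*} {N : ℕ} (Ts : ℝ) (h : Fin N → ℝ → ℝ)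
    (η : Fin N → TestFn Ts → Ω → ℝ) (θ : ℝ) (ω : Ω) : Data N Ts :=
  fun i f => (∫ t in Set.Icc (0 : ℝ) Ts, f t * h i (t - θ)) + η i f ω

/-- The law of the received multiband signal when the delay is `θ`. -/
def receivedLaw {Ω : Type*} [MeasurableSpace Ω] (μ : Measure Ω) {N : ℕ} (Ts : ℝ)
    (h : Fin N → ℝ → ℝ) (η : Fin N → TestFn Ts → Ω → ℝ) (θ : ℝ) : Measure (Data N Ts) :=
  μ.map (received Ts h η θ)

/-- Power of a pulse: the integral of the squared modulus of its Fourier transform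
(frequency in Hz). -/
def power (h : ℝ → ℝ) : ℝ := ∫ f : ℝ, ‖𝓕 (fun t : ℝ => (h t : ℂ)) f‖ ^ 2

/-- Noise variance `N₀ B` of a subband of bandwidth `B`. -/
def noiseVar (N₀ B : ℝ) : ℝ := N₀ * B

/-- Signal-to-noise ratio of a subband. -/
def snr (N₀ B : ℝ) (h : ℝ → ℝ) : ℝ := power h / noiseVar N₀ B

/-- Root-mean-square bandwidth of a pulse. -/
def rmsBandwidth (Ts : ℝ) (h : ℝ → ℝ) : ℝ :=
  Real.sqrt ((∫ t in (0 : ℝ)..Ts, (deriv h t) ^ 2) / ∫ t in (0 : ℝ)..Ts, (h t) ^ 2)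

end CognitiveRadar

end

/-! Divide subband `i` by the square root of its noise variance. The data then become a signal in
the Hilbert space `E` of tuples in L²[0, Ts] plus an isonormal Gaussian process, and the delay
enters only through the mean, a curve M(θ) in `E`. By Cameron–Martin (`map_process_shift`,
`receivedLaw_eq_shift`), the law under θ has density exp(W(G) - ‖G‖²/2) with respect to the law
under τ₀, where G = M(θ) - M(τ₀) and W is the whitened data centred at the signal for τ₀.

So the log-likelihood is affine in W along a curve. Since W is an isometry into L², norm derivatives
of M become mean-square derivatives: the score at τ₀ is W(M'(τ₀)), the second derivative is
W(M''(τ₀)) - ‖M'(τ₀)‖², and both expressions for the information equal ‖M'(τ₀)‖². Translation of a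
compactly supported C² pulse is twice differentiable in L² (`hasDerivAt_translate`), so ‖M'(τ₀)‖² is
the sum of ∫ h_i'² / σ_i². Plancherel identifies the power with ∫ h_i² and turns each term into SNR
times squared bandwidth.

The variance bound avoids differentiating the expectation of an arbitrary estimator. Cauchy–Schwarz
against the density at a finite displacement (Hammersley–Chapman–Robbins) gives (θ - τ₀)² ≤ Var ·
(exp ‖G‖² - 1); divide by (θ - τ₀)² and let θ → τ₀ among admissible delays, from one side if τ₀ is
an endpoint. -/

/-- A random variable whose moment-generating function is that of a Gaussian law is Gaussian. -/
theorem map_eq_gaussianReal_of_mgf {Ω : Type*} [MeasurableSpace Ω] {P : Measure Ω}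
    [IsProbabilityMeasure P] {Z : Ω → ℝ} (hZ : AEMeasurable Z P) (m : ℝ) (v : ℝ≥0)
    (h : ∀ t, mgf Z P t = Real.exp (m * t + v * t ^ 2 / 2)) :
    P.map Z = gaussianReal m v := by
  have hm : mgf Z P = mgf id (gaussianReal m v) := by
    ext t; rw [h, mgf_id_gaussianReal]
  have hs : integrableExpSet Z P = Set.univ := by
    rw [integrableExpSet_eq_of_mgf hm, integrableExpSet_id_gaussianReal]
  -- The transform is finite on all of ℝ, so its analytic extension is determined on all of ℂ, in
  -- particular on the imaginary axis.
  have hc : complexMGF Z P = complexMGF id (gaussianReal m v) := by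
    ext z
    exact eqOn_complexMGF_of_mgf hm (by simp [hs])
  simpa using Measure.ext_of_complexMGF_eq hZ aemeasurable_id hc

/-! ### Isonormal processes and the Cameron–Martin shift -/

/-- `W` is an isonormal Gaussian process over the inner product space `E`: it is almost surely
linear and `W F` has law `N(0, ‖F‖²)`. -/
structure IsIsonormal {E X : Type*} [NormedAddCommGroup E] [InnerProductSpace ℝ E]
    [MeasurableSpace X] (W : E → X → ℝ) (ν : Measure X) : Prop where
  measurable : ∀ F, Measurable (W F)
  map_eq : ∀ F, ν.map (W F) = gaussianReal 0 (‖F‖₊ ^ 2)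
  ae_add : ∀ F G, W (F + G) =ᵐ[ν] fun x => W F x + W G x
  ae_smul : ∀ (c : ℝ) F, W (c • F) =ᵐ[ν] fun x => c * W F x

namespace IsIsonormal

variable {E X : Type*} [NormedAddCommGroup E] [InnerProductSpace ℝ E] [MeasurableSpace X]
  {W : E → X → ℝ} {ν : Measure X}

theorem isProbabilityMeasure (hW : IsIsonormal W ν) : IsProbabilityMeasure ν := by
  have : IsProbabilityMeasure (ν.map (W 0)) := by rw [hW.map_eq]; infer_instance
  exact Measure.isProbabilityMeasure_of_map (W 0)

theorem mgf_eq (hW : IsIsonormal W ν) (F : E) (t : ℝ) :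
    mgf (W F) ν t = Real.exp (‖F‖ ^ 2 * t ^ 2 / 2) := by
  rw [mgf_gaussianReal (hW.map_eq F)]; simp

theorem integral_exp (hW : IsIsonormal W ν) (F : E) :
    ∫ x, Real.exp (W F x) ∂ν = Real.exp (‖F‖ ^ 2 / 2) := by
  have := hW.mgf_eq F 1
  simpa [mgf] using this

theorem integrable_exp (hW : IsIsonormal W ν) (F : E) :
    Integrable (fun x => Real.exp (W F x)) ν :=
  -- The Bochner integral of a non-integrable function is 0, so a nonzero value certifies
  -- integrability.
  Integrable.of_integral_ne_zero (by rw [hW.integral_exp]; positivity)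

theorem memLp (hW : IsIsonormal W ν) (F : E) : MemLp (W F) 2 ν := by
  have h : MemLp id 2 (ν.map (W F)) := by
    rw [hW.map_eq]; exact memLp_id_gaussianReal 2
  exact (memLp_map_measure_iff (by fun_prop) (hW.measurable F).aemeasurable).1 h

theorem integral_eq_zero (hW : IsIsonormal W ν) (F : E) : ∫ x, W F x ∂ν = 0 := by
  have h := integral_map (μ := ν) (φ := W F) (hW.measurable F).aemeasurable
    (f := fun y : ℝ => y) (by fun_prop)
  rw [← h, hW.map_eq, integral_id_gaussianReal]

theorem integral_sq (hW : IsIsonormal W ν) (F : E) : ∫ x, W F x ^ 2 ∂ν = ‖F‖ ^ 2 := by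
  have := hW.isProbabilityMeasure
  have h1 : Var[W F; ν] = ‖F‖ ^ 2 := by
    have h := variance_map (μ := ν) (X := id) (Y := W F) (by fun_prop) (hW.measurable F).aemeasurable
    rw [hW.map_eq, variance_id_gaussianReal] at h
    simpa using h.symm
  rwa [variance_of_integral_eq_zero (hW.measurable F).aemeasurable (hW.integral_eq_zero F)] at h1

theorem ae_sum (hW : IsIsonormal W ν) {ι : Type*} (s : Finset ι) (c : ι → ℝ) (F : ι → E) :
    W (∑ i ∈ s, c i • F i) =ᵐ[ν] fun x => ∑ i ∈ s, c i * W (F i) x := by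
  classical
  induction s using Finset.induction_on with
  | empty => simpa using hW.ae_smul 0 0
  | insert a s ha ih =>
    rw [Finset.sum_insert ha]
    filter_upwards [ih, hW.ae_add (c a • F a) (∑ i ∈ s, c i • F i), hW.ae_smul (c a) (F a)]
      with x h1 h2 h3
    rw [h2, h1, h3, Finset.sum_insert ha]

theorem ae_sub (hW : IsIsonormal W ν) (F G : E) :
    W (F - G) =ᵐ[ν] fun x => W F x - W G x := by
  filter_upwards [hW.ae_add F (-G), hW.ae_smul (-1) G] with x h1 h2
  rw [neg_one_smul] at h2
  rw [sub_eq_add_neg, h1, h2]; ring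

/-- The measure under which an isonormal process is shifted by `⟪·, G⟫`. -/
noncomputable def shift (W : E → X → ℝ) (ν : Measure X) (G : E) : Measure X :=
  ν.withDensity fun x => ENNReal.ofReal (Real.exp (W G x - ‖G‖ ^ 2 / 2))

theorem integrable_density (hW : IsIsonormal W ν) (G : E) :
    Integrable (fun x => Real.exp (W G x - ‖G‖ ^ 2 / 2)) ν := by
  simpa [Real.exp_sub] using (hW.integrable_exp G).div_const _

theorem integral_density (hW : IsIsonormal W ν) (G : E) :
    ∫ x, Real.exp (W G x - ‖G‖ ^ 2 / 2) ∂ν = 1 := by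
  simp_rw [Real.exp_sub]
  rw [integral_div, hW.integral_exp, div_self (Real.exp_pos _).ne']

theorem isProbabilityMeasure_shift (hW : IsIsonormal W ν) (G : E) :
    IsProbabilityMeasure (shift W ν G) := by
  refine ⟨?_⟩
  rw [shift, withDensity_apply _ .univ, setLIntegral_univ, ← ofReal_integral_eq_lintegral_ofReal (hW.integrable_density G)
    (ae_of_all _ fun x => (Real.exp_pos _).le), hW.integral_density, ENNReal.ofReal_one]

theorem integral_shift (hW : IsIsonormal W ν) (G : E) (f : X → ℝ) :
    ∫ x, f x ∂(shift W ν G) = ∫ x, Real.exp (W G x - ‖G‖ ^ 2 / 2) * f x ∂ν := by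
  have := hW.measurable G
  rw [shift, integral_withDensity_eq_integral_toReal_smul (by fun_prop)
    (ae_of_all _ fun x => ENNReal.ofReal_lt_top)]
  simp [ENNReal.toReal_ofReal (Real.exp_pos _).le]

/-- By almost sure linearity the tilt is absorbed into the exponent as W(tF + G); expanding ‖tF +
G‖² leaves the cross term t⟪F, G⟫, which is the new mean. -/
theorem mgf_shift (hW : IsIsonormal W ν) (F G : E) (t : ℝ) :
    mgf (W F) (shift W ν G) t = Real.exp (⟪F, G⟫ * t + ‖F‖ ^ 2 * t ^ 2 / 2) := by
  rw [mgf, hW.integral_shift]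
  have h : ∫ x, Real.exp (W G x - ‖G‖ ^ 2 / 2) * Real.exp (t * W F x) ∂ν
      = ∫ x, Real.exp (W (t • F + G) x) * Real.exp (- (‖G‖ ^ 2 / 2)) ∂ν := by
    refine integral_congr_ae ?_
    filter_upwards [hW.ae_add (t • F) G, hW.ae_smul t F] with x h1 h2
    rw [← Real.exp_add, ← Real.exp_add, h1, h2]; ring_nf
  rw [h, integral_mul_const, hW.integral_exp, ← Real.exp_add, norm_add_sq_real, norm_smul,
    inner_smul_left, mul_pow, Real.norm_eq_abs, sq_abs]
  simp only [conj_trivial]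
  ring_nf

theorem map_shift (hW : IsIsonormal W ν) (F G : E) :
    (shift W ν G).map (W F) = ν.map (fun x => W F x + ⟪F, G⟫) := by
  have := hW.isProbabilityMeasure_shift G
  have hm := hW.measurable F
  rw [map_eq_gaussianReal_of_mgf hm.aemeasurable ⟪F, G⟫ (‖F‖₊ ^ 2)
    (fun t => by rw [hW.mgf_shift]; simp)]
  have : ν.map (fun x => W F x + ⟪F, G⟫) = (ν.map (W F)).map (· + ⟪F, G⟫) := by
    rw [Measure.map_map (by fun_prop) hm]; rfl
  rw [this, hW.map_eq, gaussianReal_map_add_const, zero_add]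

omit [InnerProductSpace ℝ E] in
theorem shift_absolutelyContinuous (G : E) : shift W ν G ≪ ν :=
  withDensity_absolutelyContinuous _ _

theorem absolutelyContinuous_shift (hW : IsIsonormal W ν) (G : E) : ν ≪ shift W ν G := by
  have := hW.measurable G
  refine withDensity_absolutelyContinuous' (by fun_prop) (ae_of_all _ fun x => ?_)
  simpa using Real.exp_pos _

/-- **Cameron–Martin**: a process that is almost surely given by an isonormal process is shifted
under the tilted measure. -/
theorem map_process_shift (hW : IsIsonormal W ν) {ι : Type*} (e : ι → E) (Y : ι → X → ℝ)
    (hY : ∀ i, Measurable (Y i)) (hYW : ∀ i, Y i =ᵐ[ν] W (e i)) (G : E) :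
    (shift W ν G).map (fun x i => Y i x) = ν.map (fun x i => Y i x + ⟪e i, G⟫) := by
  have hν := hW.isProbabilityMeasure
  have hQ := hW.isProbabilityMeasure_shift G
  have hm1 : Measurable (fun x i => Y i x) := measurable_pi_lambda _ hY
  have hm2 : Measurable (fun x i => Y i x + ⟪e i, G⟫) :=
    measurable_pi_lambda _ fun i => (hY i).add_const _
  have : IsProbabilityMeasure ((shift W ν G).map (fun x i => Y i x)) :=
    Measure.isProbabilityMeasure_map hm1.aemeasurable
  have : IsProbabilityMeasure (ν.map (fun x i => Y i x + ⟪e i, G⟫)) :=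
    Measure.isProbabilityMeasure_map hm2.aemeasurable
  -- Both laws are determined by their finite-dimensional marginals. A linear functional of a
  -- marginal is almost surely a single `W F`, so `map_shift` settles each characteristic function.
  have key : ∀ I : Finset ι, ((shift W ν G).map (fun x i => Y i x)).map I.restrict
      = (ν.map (fun x i => Y i x + ⟪e i, G⟫)).map I.restrict := by
    intro I
    rw [Measure.map_map (Finset.measurable_restrict I) hm1,
      Measure.map_map (Finset.measurable_restrict I) hm2]
    have hr1 : Measurable (I.restrict ∘ fun x i => Y i x) :=
      (Finset.measurable_restrict I).comp hm1
    have hr2 : Measurable (I.restrict ∘ fun x i => Y i x + ⟪e i, G⟫) :=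
      (Finset.measurable_restrict I).comp hm2
    have : IsProbabilityMeasure ((shift W ν G).map (I.restrict ∘ fun x i => Y i x)) :=
      Measure.isProbabilityMeasure_map hr1.aemeasurable
    have : IsProbabilityMeasure (ν.map (I.restrict ∘ fun x i => Y i x + ⟪e i, G⟫)) :=
      Measure.isProbabilityMeasure_map hr2.aemeasurable
    refine Measure.ext_of_charFunDual (funext fun L => ?_)
    classical
    set c : I → ℝ := fun i => L (Pi.single i 1)
    have hL : ∀ y : I → ℝ, L y = ∑ i, c i * y i := fun y => by
      conv_lhs => rw [← Finset.univ_sum_single y, map_sum]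
      refine Finset.sum_congr rfl fun i _ => ?_
      have : Pi.single i (y i) = y i • (Pi.single i (1 : ℝ) : I → ℝ) := by
        rw [← Pi.single_smul, smul_eq_mul, mul_one]
      simp [this, c, mul_comm]
    set F : E := ∑ i, c i • e i
    have hsum : (fun x => L (I.restrict fun i => Y i x)) =ᵐ[ν] W F := by
      have h1 : ∀ᵐ x ∂ν, ∀ i : I, Y i x = W (e i) x := ae_all_iff.2 fun i => hYW i
      filter_upwards [h1, hW.ae_sum Finset.univ c (fun i : I => e i)] with x h1 h2
      rw [hL, h2]
      simp [h1]
    rw [charFunDual_apply, charFunDual_apply,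
      integral_map hr1.aemeasurable (by fun_prop), integral_map hr2.aemeasurable (by fun_prop)]
    have e1 : ∫ x, Complex.exp (L ((I.restrict ∘ fun x i => Y i x) x) * Complex.I) ∂(shift W ν G)
        = ∫ x, Complex.exp ((W F x : ℝ) * Complex.I) ∂(shift W ν G) := by
      refine integral_congr_ae ?_
      filter_upwards [(shift_absolutelyContinuous G).ae_le hsum] with x hx
      simp only [Function.comp_apply]
      rw [hx]
    have e2 : ∫ x, Complex.exp (L ((I.restrict ∘ fun x i => Y i x + ⟪e i, G⟫) x) * Complex.I) ∂ν
        = ∫ x, Complex.exp ((W F x + ⟪F, G⟫ : ℝ) * Complex.I) ∂ν := by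
      refine integral_congr_ae ?_
      filter_upwards [hsum] with x hx
      have : L ((I.restrict ∘ fun x i => Y i x + ⟪e i, G⟫) x) = W F x + ⟪F, G⟫ := by
        rw [← hx, hL, hL]
        simp [F, mul_add, Finset.sum_add_distrib, sum_inner, inner_smul_left]
      rw [this]
    rw [e1, e2]
    have hm := hW.measurable F
    rw [← integral_map (μ := shift W ν G) (φ := W F) hm.aemeasurable
        (f := fun y : ℝ => Complex.exp ((y : ℝ) * Complex.I)) (by fun_prop),
      hW.map_shift F G, integral_map (by fun_prop) (by fun_prop)]
  exact IsProjectiveLimit.unique (P := fun I => (ν.map (fun x i => Y i x + ⟪e i, G⟫)).map I.restrict)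
    (fun I => key I) (fun I => rfl)

end IsIsonormal

/-! ### Fisher information and Cramér–Rao bound for shifts -/

theorem sq_covariance_le {X : Type*} [MeasurableSpace X] {ν : Measure X} [IsProbabilityMeasure ν]
    {f g : X → ℝ} (hf : MemLp f 2 ν) (hg : MemLp g 2 ν) :
    cov[f, g; ν] ^ 2 ≤ Var[f; ν] * Var[g; ν] := by
  -- The variance of f + c g is a nonnegative quadratic in c, so its discriminant is nonpositive.
  have h : ∀ c : ℝ, 0 ≤ Var[g; ν] * (c * c) + 2 * cov[f, g; ν] * c + Var[f; ν] := fun c => by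
    have h1 := variance_nonneg (f + fun x => c * g x) ν
    rw [variance_add hf (hg.const_mul c), variance_const_mul, covariance_const_mul_right] at h1
    linarith
  have := discrim_le_zero h
  rw [discrim] at this
  linarith

namespace IsIsonormal

variable {E X : Type*} [NormedAddCommGroup E] [InnerProductSpace ℝ E] [MeasurableSpace X]
  {W : E → X → ℝ} {ν : Measure X}

/-- This isometry converts norm convergence in `E` into mean-square convergence. -/
theorem eLpNorm_eq (hW : IsIsonormal W ν) (F : E) :
    eLpNorm (W F) 2 ν = ENNReal.ofReal ‖F‖ := by
  rw [(hW.memLp F).eLpNorm_eq_integral_rpow_norm two_ne_zero ENNReal.ofNat_ne_top]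
  have : ∀ x, ‖W F x‖ ^ (2 : ℝ≥0∞).toReal = W F x ^ 2 := fun x => by simp
  simp_rw [this, hW.integral_sq]
  rw [← Real.rpow_natCast, ← Real.rpow_mul (norm_nonneg _)]
  simp

theorem shift_zero (hW : IsIsonormal W ν) : shift W ν (0 : E) = ν := by
  have h : (fun x => ENNReal.ofReal (Real.exp (W 0 x - ‖(0 : E)‖ ^ 2 / 2))) =ᵐ[ν] 1 := by
    filter_upwards [hW.ae_smul 0 0] with x hx
    rw [zero_smul, zero_mul] at hx
    simp [hx]
  rw [shift, withDensity_congr_ae h, withDensity_one]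

theorem llr_shift (hW : IsIsonormal W ν) (G : E) :
    llr (shift W ν G) ν =ᵐ[ν] fun x => W G x - ‖G‖ ^ 2 / 2 := by
  have := hW.isProbabilityMeasure
  have hm := hW.measurable G
  filter_upwards [Measure.rnDeriv_withDensity ν (f := fun x =>
    ENNReal.ofReal (Real.exp (W G x - ‖G‖ ^ 2 / 2))) (by fun_prop)] with x hx
  rw [llr, shift, hx, ENNReal.toReal_ofReal (Real.exp_pos _).le, Real.log_exp]

/-- A random function that is affine in an isonormal process, along a differentiable curve, is
differentiable in mean square. -/
theorem hasMeanSquareDeriv (hW : IsIsonormal W ν) {γ : ℝ → E} {γ' : E} {c : ℝ → ℝ} {c' θ : ℝ}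
    {ℓ : ℝ → X → ℝ} {d : X → ℝ} (hγ : HasDerivAt γ γ' θ) (hc : HasDerivAt c c' θ)
    (hℓ : ∀ θ', ℓ θ' =ᵐ[ν] fun x => W (γ θ') x + c θ')
    (hd : d =ᵐ[ν] fun x => W γ' x + c') : HasMeanSquareDeriv ν ℓ θ d := by
  have := hW.isProbabilityMeasure
  refine ⟨((hW.memLp γ').add (memLp_const c')).ae_eq hd.symm, ?_⟩
  set δ : ℝ → E := fun u => u⁻¹ • (γ (θ + u) - γ θ) - γ'
  set κ : ℝ → ℝ := fun u => u⁻¹ * (c (θ + u) - c θ) - c'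
  have hδ : Tendsto δ (𝓝[≠] 0) (𝓝 0) := by
    simpa [δ] using (hasDerivAt_iff_tendsto_slope_zero.1 hγ).sub_const γ'
  have hκ : Tendsto κ (𝓝[≠] 0) (𝓝 0) := by
    simpa [κ] using (hasDerivAt_iff_tendsto_slope_zero.1 hc).sub_const c'
  -- By almost sure linearity the error of the difference quotient is W of the error along the
  -- curve, plus a deterministic error.
  have hae : ∀ u, (fun x => u⁻¹ * (ℓ (θ + u) x - ℓ θ x) - d x)
      =ᵐ[ν] W (δ u) + fun _ => κ u := by
    intro u
    filter_upwards [hℓ (θ + u), hℓ θ, hd, hW.ae_sub (u⁻¹ • (γ (θ + u) - γ θ)) γ',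
      hW.ae_smul u⁻¹ (γ (θ + u) - γ θ), hW.ae_sub (γ (θ + u)) (γ θ)] with x h1 h2 h3 h4 h5 h6
    simp only [Pi.add_apply, δ, κ]
    rw [h1, h2, h3, h4, h5, h6]; ring
  have hle : ∀ u, eLpNorm (fun x => u⁻¹ * (ℓ (θ + u) x - ℓ θ x) - d x) 2 ν
      ≤ ENNReal.ofReal (‖δ u‖ + ‖κ u‖) := by
    intro u
    rw [eLpNorm_congr_ae (hae u)]
    refine (eLpNorm_add_le (hW.measurable _).aestronglyMeasurable
      aestronglyMeasurable_const (by norm_num)).trans ?_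
    rw [hW.eLpNorm_eq, eLpNorm_const _ (by norm_num) (NeZero.ne ν),
      ENNReal.ofReal_add (norm_nonneg _) (norm_nonneg _),
      ofReal_norm (κ u)]
    simp
  refine tendsto_of_tendsto_of_tendsto_of_le_of_le tendsto_const_nhds ?_ (fun u => zero_le) hle
  have := ENNReal.tendsto_ofReal (hδ.norm.add hκ.norm)
  simpa using this

/-- Fisher information of a smooth family of shifts of an isonormal process. -/
theorem hasFisherInformation (hW : IsIsonormal W ν) {P : ℝ → Measure X} {M M' : ℝ → E} {M'' : E}
    {θ₀ : ℝ} (hP : ∀ θ, P θ = shift W ν (M θ - M θ₀)) (hM : ∀ θ, HasDerivAt M (M' θ) θ)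
    (hM' : HasDerivAt M' M'' θ₀) : HasFisherInformation P θ₀ (‖M' θ₀‖ ^ 2) := by
  have := hW.isProbabilityMeasure
  have h0 : P θ₀ = ν := by rw [hP, sub_self, hW.shift_zero]
  rw [HasFisherInformation, h0]
  have hD : ∀ θ, HasDerivAt (fun θ' => M θ' - M θ₀) (M' θ) θ := fun θ => (hM θ).sub_const _
  -- The score differentiates W(D) - ‖D‖²/2 with D = M θ - M θ₀. Differentiating ⟪D, M' θ⟫ at θ₀,
  -- where D = 0, leaves only ‖M' θ₀‖².
  refine ⟨.of_forall fun θ => ?_, fun θ x => W (M' θ) x + -⟪M θ - M θ₀, M' θ⟫,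
    fun x => W M'' x + -‖M' θ₀‖ ^ 2, .of_forall fun θ => ?_, ?_, ?_, ?_⟩
  · rw [hP]
    exact ⟨shift_absolutelyContinuous _, hW.absolutelyContinuous_shift _⟩
  · refine hW.hasMeanSquareDeriv (γ := fun θ' => M θ' - M θ₀)
      (c := fun θ' => -(‖M θ' - M θ₀‖ ^ 2 / 2)) (hD θ) ?_ (fun θ' => ?_) .rfl
    · exact ((hD θ).norm_sq.div_const 2).neg.congr_deriv (by ring)
    · simp only [hP]
      filter_upwards [hW.llr_shift (M θ' - M θ₀)] with x hx
      rw [hx, sub_eq_add_neg]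
  · refine hW.hasMeanSquareDeriv (γ := M') (c := fun θ => -⟪M θ - M θ₀, M' θ⟫) hM' ?_
      (fun _ => .rfl) .rfl
    exact ((hD θ₀).inner ℝ hM').neg.congr_deriv (by simp)
  · rw [integral_add ((hW.memLp _).integrable one_le_two) (integrable_const _),
      hW.integral_eq_zero]
    simp
  · simp [hW.integral_sq]

/-- The second moment of the likelihood ratio; subtracting 1 gives the chi-square divergence in the
Hammersley–Chapman–Robbins bound. -/
theorem integral_density_sq (hW : IsIsonormal W ν) (G : E) :
    ∫ x, Real.exp (W G x - ‖G‖ ^ 2 / 2) ^ 2 ∂ν = Real.exp (‖G‖ ^ 2) := by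
  have h : ∫ x, Real.exp (W G x - ‖G‖ ^ 2 / 2) ^ 2 ∂ν
      = ∫ x, Real.exp (2 * W G x) * Real.exp (-‖G‖ ^ 2) ∂ν := by
    congr 1; ext x
    rw [← Real.exp_nat_mul, ← Real.exp_add]; push_cast; ring_nf
  have h2 := hW.mgf_eq G 2
  rw [mgf] at h2
  rw [h, integral_mul_const, h2, ← Real.exp_add]
  ring_nf

theorem memLp_density (hW : IsIsonormal W ν) (G : E) :
    MemLp (fun x => Real.exp (W G x - ‖G‖ ^ 2 / 2)) 2 ν := by
  have hm := hW.measurable G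
  refine (memLp_two_iff_integrable_sq (by fun_prop)).2 (Integrable.of_integral_ne_zero ?_)
  rw [hW.integral_density_sq]; positivity

/-- **Hammersley–Chapman–Robbins inequality** for a shift of an isonormal process. -/
theorem sq_integral_sub_le (hW : IsIsonormal W ν) (G : E) {f : X → ℝ} (hf : MemLp f 2 ν) :
    (∫ x, f x ∂(shift W ν G) - ∫ x, f x ∂ν) ^ 2 ≤ Var[f; ν] * (Real.exp (‖G‖ ^ 2) - 1) := by
  have := hW.isProbabilityMeasure
  have hD := hW.memLp_density G
  set D : X → ℝ := fun x => Real.exp (W G x - ‖G‖ ^ 2 / 2) with hDdef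
  have hvar : Var[D; ν] = Real.exp (‖G‖ ^ 2) - 1 := by
    rw [variance_eq_sub hD]
    simp only [hDdef, Pi.pow_apply]
    rw [hW.integral_density_sq, hW.integral_density, one_pow]
  -- Since the density has mean 1, its covariance with f is the change of the mean of f under the
  -- shift.
  have hcov : cov[f, D; ν] = ∫ x, f x ∂(shift W ν G) - ∫ x, f x ∂ν := by
    rw [covariance_eq_sub hf hD, hW.integral_shift, hW.integral_density, mul_one]
    simp only [Pi.mul_apply, mul_comm]
    rfl
  rw [← hcov, ← hvar]
  exact sq_covariance_le hf hD

/-- The Cramér–Rao bound for a differentiable family of shifts of an isonormal process. -/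
theorem cramerRao_le_evariance (hW : IsIsonormal W ν) {P : ℝ → Measure X} {M : ℝ → E} {M' : E}
    {θ₀ : ℝ} (hP : ∀ θ, P θ = shift W ν (M θ - M θ₀)) (hM : HasDerivAt M M' θ₀) (hM' : M' ≠ 0)
    {Θ : Set ℝ} (hθ₀ : θ₀ ∈ Θ) (hΘ : AccPt θ₀ (𝓟 Θ)) {est : X → ℝ}
    (hest : IsUnbiasedEstimator P Θ est) :
    ENNReal.ofReal (1 / ‖M'‖ ^ 2) ≤ eVar[est; P θ₀] := by
  have := hW.isProbabilityMeasure
  have h0 : P θ₀ = ν := by rw [hP, sub_self, hW.shift_zero]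
  rw [h0]
  by_cases hL : MemLp est 2 ν
  swap
  · rw [evariance_eq_top hest.1.aestronglyMeasurable hL]; exact le_top
  rw [← hL.ofReal_variance_eq]
  refine ENNReal.ofReal_le_ofReal ?_
  have hpos : 0 < ‖M'‖ ^ 2 := by positivity
  rw [div_le_iff₀ hpos]
  have hineq : ∀ᶠ θ in 𝓝[≠] θ₀ ⊓ 𝓟 Θ,
      1 ≤ Var[est; ν] * ((Real.exp (‖M θ - M θ₀‖ ^ 2) - 1) / (θ - θ₀) ^ 2) := by
    filter_upwards [mem_inf_of_left self_mem_nhdsWithin, mem_inf_of_right (mem_principal_self Θ)]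
      with θ hne hθ
    have h := hW.sq_integral_sub_le (M θ - M θ₀) hL
    have h1 := (hest.2 θ hθ).2
    have h2 := (hest.2 θ₀ hθ₀).2
    rw [hP] at h1
    rw [h0] at h2
    rw [h1, h2] at h
    have : 0 < (θ - θ₀) ^ 2 := by have := sub_ne_zero.2 hne; positivity
    rwa [← mul_div_assoc, le_div_iff₀ this, one_mul]
  have hlim : Tendsto (fun θ => (Real.exp (‖M θ - M θ₀‖ ^ 2) - 1) / (θ - θ₀) ^ 2) (𝓝[≠] θ₀)
      (𝓝 (‖M'‖ ^ 2)) := by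
    have hs : Tendsto (fun θ => ‖slope M θ₀ θ‖ ^ 2) (𝓝[≠] θ₀) (𝓝 (‖M'‖ ^ 2)) :=
      (hasDerivAt_iff_tendsto_slope.1 hM).norm.pow 2
    have hg : Tendsto (fun θ => ‖M θ - M θ₀‖ ^ 2) (𝓝[≠] θ₀) (𝓝 0) := by
      have : ContinuousAt (fun θ => ‖M θ - M θ₀‖ ^ 2) θ₀ :=
        ((hM.continuousAt.sub continuousAt_const).norm.pow 2)
      simpa using this.tendsto.mono_left nhdsWithin_le_nhds
    -- `dslope` extends (exp x - 1)/x continuously by 1 at x = 0, which covers any θ ≠ θ₀ with M θ =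
    -- M θ₀.
    have hd : Tendsto (fun θ => dslope Real.exp 0 (‖M θ - M θ₀‖ ^ 2)) (𝓝[≠] θ₀) (𝓝 1) := by
      have hcont : ContinuousAt (dslope Real.exp 0) 0 :=
        continuousAt_dslope_same.2 Real.differentiableAt_exp
      have := hcont.tendsto.comp hg
      simpa [dslope_same, Function.comp_def] using this
    have := hd.mul hs
    rw [one_mul] at this
    refine this.congr' ?_
    filter_upwards [self_mem_nhdsWithin] with θ hne
    have hne : θ - θ₀ ≠ 0 := sub_ne_zero.2 hne
    have key := sub_smul_dslope Real.exp 0 (‖M θ - M θ₀‖ ^ 2)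
    rw [sub_zero, Real.exp_zero, smul_eq_mul] at key
    rw [← key, slope_def_module, norm_smul, mul_pow, norm_inv, Real.norm_eq_abs, inv_pow, sq_abs]
    field_simp
  have hne : (𝓝[≠] θ₀ ⊓ 𝓟 Θ).NeBot := hΘ
  exact ge_of_tendsto ((hlim.mono_left inf_le_left).const_mul _) hineq

end IsIsonormal

/-! ### Plancherel for C² pulses -/

/-- The Fourier transform of a compactly supported `C²` function is integrable. -/
theorem integrable_fourier_of_contDiff_two {f : ℝ → ℂ} (hf : ContDiff ℝ 2 f)
    (hc : HasCompactSupport f) : Integrable (𝓕 f) := by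
  have hf1 : ContDiff ℝ 1 (deriv f) := ((contDiff_succ_iff_deriv (n := 1)).1 hf).2.2
  have hf2 : Continuous (deriv (deriv f)) := hf1.continuous_deriv le_rfl
  have i0 : Integrable f := hf.continuous.integrable_of_hasCompactSupport hc
  have i1 : Integrable (deriv f) := hf1.continuous.integrable_of_hasCompactSupport hc.deriv
  have i2 : Integrable (deriv (deriv f)) :=
    hf2.integrable_of_hasCompactSupport hc.deriv.deriv
  have hF : ∀ x, 𝓕 (deriv (deriv f)) x = -((2 * Real.pi * x) ^ 2 : ℝ) * 𝓕 f x := by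
    intro x
    rw [Real.fourier_deriv i1 (hf1.differentiable one_ne_zero) i2,
      Real.fourier_deriv i0 (hf.differentiable two_ne_zero) i1]
    simp only [smul_eq_mul]
    push_cast
    linear_combination (2 * Real.pi * x) ^ 2 * 𝓕 f x * Complex.I_sq
  have hbound : ∀ g : ℝ → ℂ, ∀ x, ‖𝓕 g x‖ ≤ ∫ y, ‖g y‖ := fun g x =>
    VectorFourier.norm_fourierIntegral_le_integral_norm _ _ _ _ _
  have hcont : Continuous (𝓕 f) := VectorFourier.fourierIntegral_continuous
    Real.continuous_fourierChar (by exact continuous_inner) i0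
  -- Bounding the transforms of f and f'' by L¹ norms gives (1 + x²)‖𝓕 f x‖ ≤ C, hence an integrable
  -- majorant.
  set C := (∫ y, ‖f y‖) + ∫ y, ‖deriv (deriv f) y‖
  refine Integrable.mono' (integrable_inv_one_add_sq.const_mul C)
    hcont.aestronglyMeasurable (ae_of_all _ fun x => ?_)
  have h0 := hbound f x
  have h2 := hbound (deriv (deriv f)) x
  rw [hF, norm_mul, norm_neg, Complex.norm_real, Real.norm_of_nonneg (sq_nonneg _)] at h2
  have hx : 0 < 1 + x ^ 2 := by positivity
  rw [← div_eq_mul_inv, le_div_iff₀ hx]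
  have hpi : x ^ 2 ≤ (2 * Real.pi * x) ^ 2 := by
    have : 1 ≤ 2 * Real.pi := by linarith [Real.pi_gt_three]
    rw [mul_pow]
    exact le_mul_of_one_le_left (sq_nonneg x) (one_le_pow₀ this)
  nlinarith [mul_le_mul_of_nonneg_right hpi (norm_nonneg (𝓕 f x))]

/-- **Plancherel** for compactly supported `C²` functions. -/
theorem integral_norm_sq_fourier_of_contDiff_two {f : ℝ → ℂ} (hf : ContDiff ℝ 2 f)
    (hc : HasCompactSupport f) : ∫ ξ, ‖𝓕 f ξ‖ ^ 2 = ∫ x, ‖f x‖ ^ 2 := by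
  have i0 : Integrable f := hf.continuous.integrable_of_hasCompactSupport hc
  have iF := integrable_fourier_of_contDiff_two hf hc
  -- Moving one transform across the pairing of 𝓕 f with itself produces the inverse transform of 𝓕
  -- f, which is f.
  have h := VectorFourier.integral_sesq_fourierIntegral_eq_neg_flip (innerSL ℂ)
    (L := innerₗ ℝ) (μ := volume) (ν := volume) Real.continuous_fourierChar continuous_inner i0 iF
  have hinv : VectorFourier.fourierIntegral Real.fourierChar volume (-(innerₗ ℝ).flip) (𝓕 f)
      = f := by
    have := hf.continuous.fourierInv_fourier_eq i0 iF
    simpa using! this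
  rw [hinv] at h
  apply Complex.ofRealLI.injective
  have h' : ∫ ξ, inner ℂ (𝓕 f ξ) (𝓕 f ξ) = ∫ x, inner ℂ (f x) (f x) := h
  simp only [inner_self_eq_norm_sq_to_K] at h'
  simpa [← Complex.ofReal_pow, integral_ofReal, integral_complex_ofReal] using h'

/-! ### Translated pulses in L²[0, Ts] -/

namespace CognitiveRadar

theorem power_eq {h : ℝ → ℝ} (hh : ContDiff ℝ 2 h) (hc : HasCompactSupport h) :
    power h = ∫ t, h t ^ 2 := by
  have h1 : ContDiff ℝ 2 (fun t : ℝ => (h t : ℂ)) := Complex.ofRealCLM.contDiff.comp hh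
  have h2 : HasCompactSupport (fun t : ℝ => (h t : ℂ)) := hc.comp_left (g := Complex.ofReal) rfl
  rw [power, integral_norm_sq_fourier_of_contDiff_two h1 h2]
  simp

theorem memLp_translate (Ts : ℝ) {g : ℝ → ℝ} (hg : Continuous g) (hc : HasCompactSupport g)
    (θ : ℝ) : MemLp (fun t => g (t - θ)) 2 (volume.restrict (Set.Icc (0 : ℝ) Ts)) := by
  refine Continuous.memLp_of_hasCompactSupport (by fun_prop) ?_
  exact hc.comp_homeomorph (Homeomorph.subRight θ)

/-- The translate of a pulse, as an element of `L²[0, Ts]`. -/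
noncomputable def translate (Ts : ℝ) {g : ℝ → ℝ} (hg : Continuous g) (hc : HasCompactSupport g)
    (θ : ℝ) : TestFn Ts := (memLp_translate Ts hg hc θ).toLp _

variable {Ts : ℝ} {g : ℝ → ℝ}

theorem translate_ae (hg : Continuous g) (hc : HasCompactSupport g) (θ : ℝ) :
    translate Ts hg hc θ =ᵐ[volume.restrict (Set.Icc (0 : ℝ) Ts)] fun t => g (t - θ) :=
  MemLp.coeFn_toLp _

theorem inner_translate (hg : Continuous g) (hc : HasCompactSupport g) (θ : ℝ) (f : TestFn Ts) :
    ⟪f, translate Ts hg hc θ⟫ = ∫ t in Set.Icc (0 : ℝ) Ts, f t * g (t - θ) := by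
  rw [L2.inner_def]
  refine integral_congr_ae ?_
  filter_upwards [translate_ae hg hc θ] with t ht
  rw [ht]
  simp [mul_comm]

theorem norm_sq_translate (hg : Continuous g) (hc : HasCompactSupport g) (θ : ℝ) :
    ‖translate Ts hg hc θ‖ ^ 2 = ∫ t in Set.Icc (0 : ℝ) Ts, g (t - θ) ^ 2 := by
  rw [← real_inner_self_eq_norm_sq, inner_translate]
  refine integral_congr_ae ?_
  filter_upwards [translate_ae hg hc θ] with t ht
  rw [ht, sq]

/-- Translation of a compactly supported `C¹` pulse is differentiable in `L²`. -/
theorem hasDerivAt_translate (hg : ContDiff ℝ 1 g) (hc : HasCompactSupport g) (θ : ℝ) :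
    HasDerivAt (translate Ts hg.continuous hc)
      (-translate Ts (hg.continuous_deriv le_rfl) hc.deriv θ) θ := by
  have hg' := hg.continuous_deriv le_rfl
  rw [hasDerivAt_iff_isLittleO, Asymptotics.isLittleO_iff]
  intro ε hε
  -- K is the constant bounding the L² norm by a uniform bound on the finite interval; K + 1 avoids
  -- division by zero.
  set K : ℝ := measureUnivNNReal (volume.restrict (Set.Icc (0 : ℝ) Ts)) ^ (2 : ℝ≥0∞).toReal⁻¹
  have hK : 0 ≤ K := by positivity
  have hε' : 0 < ε / (K + 1) := by positivity
  obtain ⟨δ, hδ, hU⟩ := Metric.uniformContinuous_iff.1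
    (hc.deriv.uniformContinuous_of_continuous hg') _ hε'
  filter_upwards [Metric.ball_mem_nhds θ hδ] with θ' hθ'
  have hpt : ∀ t, ‖g (t - θ') - g (t - θ) - (θ' - θ) * (-deriv g (t - θ))‖
      ≤ ε / (K + 1) * ‖θ' - θ‖ := by
    intro t
    -- Mean value inequality in the delay s, after subtracting the linear part at θ. Uniform
    -- continuity of g' makes δ independent of t.
    have hd : ∀ s ∈ Metric.ball θ δ, HasDerivWithinAt (fun s => g (t - s) + s * deriv g (t - θ))
        (-deriv g (t - s) + deriv g (t - θ)) (Metric.ball θ δ) s := by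
      intro s _
      have h1 : HasDerivAt (fun s => g (t - s)) (-deriv g (t - s)) s := by
        have := ((hg.differentiable one_ne_zero).differentiableAt (x := t - s)).hasDerivAt.comp s
          ((hasDerivAt_id s).const_sub t)
        exact this.congr_deriv (by ring)
      exact (h1.add ((hasDerivAt_id s).mul_const (deriv g (t - θ)))).congr_deriv
        (by rw [one_mul]) |>.hasDerivWithinAt
    have hb : ∀ s ∈ Metric.ball θ δ,
        ‖-deriv g (t - s) + deriv g (t - θ)‖ ≤ ε / (K + 1) := by
      intro s hs
      have := hU (a := t - s) (b := t - θ) (by rwa [dist_sub_left])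
      rw [Real.dist_eq, abs_sub_comm] at this
      rw [neg_add_eq_sub, Real.norm_eq_abs]
      exact this.le
    have h := (convex_ball θ δ).norm_image_sub_le_of_norm_hasDerivWithin_le hd hb
      (Metric.mem_ball_self hδ) hθ'
    rwa [show g (t - θ') + θ' * deriv g (t - θ) - (g (t - θ) + θ * deriv g (t - θ))
      = g (t - θ') - g (t - θ) - (θ' - θ) * (-deriv g (t - θ)) by ring] at h
  have hle := Lp.norm_le_of_ae_bound (p := 2)
    (f := translate Ts hg.continuous hc θ' - translate Ts hg.continuous hc θ
      - (θ' - θ) • -translate Ts hg' hc.deriv θ)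
    (C := ε / (K + 1) * ‖θ' - θ‖) (by positivity) (by
      filter_upwards [translate_ae (Ts := Ts) hg.continuous hc θ',
        translate_ae (Ts := Ts) hg.continuous hc θ,
        translate_ae (Ts := Ts) hg' hc.deriv θ,
        Lp.coeFn_sub (translate Ts hg.continuous hc θ' - translate Ts hg.continuous hc θ)
          ((θ' - θ) • -translate Ts hg' hc.deriv θ),
        Lp.coeFn_sub (translate Ts hg.continuous hc θ') (translate Ts hg.continuous hc θ),
        Lp.coeFn_smul (θ' - θ) (-translate Ts hg' hc.deriv θ),
        Lp.coeFn_neg (translate Ts hg' hc.deriv θ)] with t h1 h2 h3 h4 h5 h6 h7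
      rw [h4, Pi.sub_apply, h5, Pi.sub_apply, h6, Pi.smul_apply, h7, Pi.neg_apply, h1, h2, h3]
      exact hpt t)
  refine hle.trans ?_
  change K * (ε / (K + 1) * ‖θ' - θ‖) ≤ ε * ‖θ' - θ‖
  rw [← mul_assoc]
  refine mul_le_mul_of_nonneg_right ?_ (norm_nonneg _)
  rw [mul_div_assoc', div_le_iff₀ (by positivity)]
  nlinarith

variable {w : ℝ}

/-- For an admissible delay the translated support [θ, θ + w] lies in [0, Ts], so no part of the
pulse is cut off. -/
theorem setIntegral_translate {f : ℝ → ℝ} (hf : ∀ t, t ∉ Set.Icc 0 w → f t = 0) {θ : ℝ}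
    (hθ : θ ∈ Set.Icc 0 (Ts - w)) : ∫ t in Set.Icc (0 : ℝ) Ts, f (t - θ) = ∫ t, f t := by
  rw [setIntegral_eq_integral_of_forall_compl_eq_zero, integral_sub_right_eq_self]
  intro t ht
  refine hf _ fun h => ht ?_
  exact ⟨by linarith [h.1, hθ.1], by linarith [h.2, hθ.2]⟩

theorem intervalIntegral_eq_integral {f : ℝ → ℝ} (hf : ∀ t, t ∉ Set.Icc 0 w → f t = 0)
    (hw : 0 ≤ w) (hwT : w ≤ Ts) : ∫ t in (0 : ℝ)..Ts, f t = ∫ t, f t := by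
  rw [intervalIntegral.integral_of_le (hw.trans hwT), ← integral_Icc_eq_integral_Ioc]
  simpa using setIntegral_translate (Ts := Ts) hf (θ := 0) ⟨le_rfl, by linarith⟩

theorem hasCompactSupport_of_support (hg : ∀ t, t ∉ Set.Icc 0 w → g t = 0) :
    HasCompactSupport g :=
  HasCompactSupport.intro isCompact_Icc fun {t} => hg t

theorem deriv_eq_zero_of_support (hg : ∀ t, t ∉ Set.Icc 0 w → g t = 0) :
    ∀ t, t ∉ Set.Icc 0 w → deriv g t = 0 := by
  intro t ht
  have : g =ᶠ[𝓝 t] fun _ => 0 := by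
    filter_upwards [isClosed_Icc.isOpen_compl.mem_nhds ht] with s hs using hg s hs
  rw [this.deriv_eq, deriv_const]

theorem integral_sq_pos (hg : Continuous g) (hc : HasCompactSupport g) (h0 : g ≠ 0) :
    0 < ∫ t, g t ^ 2 := by
  obtain ⟨t, ht⟩ := Function.ne_iff.1 h0
  refine (hg.pow 2).integral_pos_of_hasCompactSupport_nonneg_nonzero ?_ (fun t => sq_nonneg _)
    (x := t) (pow_ne_zero 2 ht)
  exact hc.comp_left (g := fun x : ℝ => x ^ 2) (by simp)

/-- A function with zero derivative is constant, and compact support in ℝ forces that constant to be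
0. This makes the Fisher information positive. -/
theorem deriv_ne_zero_of_hasCompactSupport (hg : Differentiable ℝ g) (hc : HasCompactSupport g)
    (h0 : g ≠ 0) : deriv g ≠ 0 := by
  intro h
  obtain ⟨s, hs⟩ : ∃ s, g s = 0 := by
    by_contra! hne
    have : tsupport g = Set.univ := by
      rw [tsupport, Function.support_eq_univ hne, closure_univ]
    exact noncompact_univ ℝ (this ▸ hc)
  refine h0 (funext fun t => ?_)
  rw [is_const_of_deriv_eq_zero hg (fun x => congrFun h x) t s, hs, Pi.zero_apply]

/-- The contribution of one subband to the Fisher information. -/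
theorem snr_mul_rmsBandwidth_sq {h : ℝ → ℝ} (hh : ContDiff ℝ 2 h)
    (hs : ∀ t, t ∉ Set.Icc 0 w → h t = 0) (h0 : h ≠ 0) (hw : 0 ≤ w) (hwT : w ≤ Ts) (N₀ B : ℝ) :
    snr N₀ B h * rmsBandwidth Ts h ^ 2 = (∫ t, deriv h t ^ 2) / noiseVar N₀ B := by
  have hc := hasCompactSupport_of_support hs
  have hpos := integral_sq_pos hh.continuous hc h0
  have e1 : ∫ t in (0 : ℝ)..Ts, h t ^ 2 = ∫ t, h t ^ 2 :=
    intervalIntegral_eq_integral (fun t ht => by simp [hs t ht]) hw hwT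
  have e2 : ∫ t in (0 : ℝ)..Ts, deriv h t ^ 2 = ∫ t, deriv h t ^ 2 :=
    intervalIntegral_eq_integral (fun t ht => by simp [deriv_eq_zero_of_support hs t ht]) hw hwT
  have hnn : 0 ≤ ∫ t, deriv h t ^ 2 := integral_nonneg fun t => sq_nonneg _
  -- By Plancherel the power equals the denominator of the squared bandwidth, so the two cancel.
  rw [snr, rmsBandwidth, e1, e2, Real.sq_sqrt (by positivity), power_eq hh hc]
  field_simp

end CognitiveRadar

/-! ### Transport from the sample space to the data space -/

namespace IsIsonormal

variable {E X Y : Type*} [NormedAddCommGroup E] [InnerProductSpace ℝ E] [MeasurableSpace X]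
  [MeasurableSpace Y] {W : E → X → ℝ} {V : E → Y → ℝ} {ν : Measure X} {φ : X → Y}

theorem map (hW : IsIsonormal W ν) (hφ : Measurable φ) (hV : ∀ F, Measurable (V F))
    (hVW : ∀ F x, V F (φ x) = W F x) : IsIsonormal V (ν.map φ) where
  measurable := hV
  map_eq F := by
    rw [Measure.map_map (hV F) hφ, ← hW.map_eq F]
    congr 1; ext x; exact hVW F x
  ae_add F G := by
    have := hV F; have := hV G; have := hV (F + G)
    refine (ae_map_iff hφ.aemeasurable (measurableSet_eq_fun (by fun_prop) (by fun_prop))).2 ?_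
    simpa only [hVW] using! hW.ae_add F G
  ae_smul c F := by
    have := hV F; have := hV (c • F)
    refine (ae_map_iff hφ.aemeasurable (measurableSet_eq_fun (by fun_prop) (by fun_prop))).2 ?_
    simpa only [hVW] using! hW.ae_smul c F

-- The density factors through φ, so tilting commutes with push-forward.
omit [InnerProductSpace ℝ E] in
theorem map_shift_eq (hφ : Measurable φ) (hV : ∀ F, Measurable (V F))
    (hVW : ∀ F x, V F (φ x) = W F x) (G : E) :
    (shift W ν G).map φ = shift V (ν.map φ) G := by
  have := hV G
  ext s hs
  rw [Measure.map_apply hφ hs, shift, shift, withDensity_apply _ (hφ hs), withDensity_apply _ hs,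
    setLIntegral_map hs (by fun_prop) hφ]
  simp_rw [hVW]

end IsIsonormal

/-! ### White noise and whitening of the multiband data -/

namespace CognitiveRadar

namespace IsWhiteGaussianNoise

variable {Ω : Type*} [MeasurableSpace Ω] {μ : Measure Ω} {Ts v : ℝ} {W : TestFn Ts → Ω → ℝ}

theorem memLp (hW : IsWhiteGaussianNoise μ Ts v W) (f : TestFn Ts) : MemLp (W f) 2 μ :=
  (hW.gaussian.hasGaussianLaw_eval f).memLp_two

/-- Linearity is not assumed of the noise. The mean square of the defect expands into covariances,
which cancel by bilinearity of the inner product. -/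
theorem ae_linear (hW : IsWhiteGaussianNoise μ Ts v W) (a b : ℝ) (f g : TestFn Ts) :
    W (a • f + b • g) =ᵐ[μ] fun ω => a * W f ω + b * W g ω := by
  set k := a • f + b • g with hk
  have hi : ∀ p q : TestFn Ts, Integrable (fun ω => W p ω * W q ω) μ := fun p q =>
    (hW.memLp p).integrable_mul (hW.memLp q)
  have hzero : ∫ ω, (W k ω - (a * W f ω + b * W g ω)) ^ 2 ∂μ = 0 := by
    have : ∀ ω, (W k ω - (a * W f ω + b * W g ω)) ^ 2 = W k ω * W k ω
        + a ^ 2 * (W f ω * W f ω) + b ^ 2 * (W g ω * W g ω) + (-2 * a) * (W k ω * W f ω)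
        + (-2 * b) * (W k ω * W g ω) + (2 * a * b) * (W f ω * W g ω) := fun ω => by ring
    simp_rw [this]
    have i1 := hi k k
    have i2 := (hi f f).const_mul (a ^ 2)
    have i3 := (hi g g).const_mul (b ^ 2)
    have i4 := (hi k f).const_mul (-2 * a)
    have i5 := (hi k g).const_mul (-2 * b)
    have i6 := (hi f g).const_mul (2 * a * b)
    rw [integral_add ?_ i6, integral_add ?_ i5, integral_add ?_ i4, integral_add ?_ i3,
      integral_add i1 i2]
    rotate_left
    · exact i1.add i2
    · exact (i1.add i2).add i3
    · exact ((i1.add i2).add i3).add i4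
    · exact (((i1.add i2).add i3).add i4).add i5
    simp only [integral_const_mul, hW.covariance]
    simp only [hk, inner_add_left, inner_add_right, real_inner_smul_left, real_inner_smul_right,
      real_inner_comm f g]
    ring
  have hint : Integrable (fun ω => (W k ω - (a * W f ω + b * W g ω)) ^ 2) μ :=
    ((hW.memLp k).sub (((hW.memLp f).const_mul a).add ((hW.memLp g).const_mul b))).integrable_sq
  filter_upwards [(integral_eq_zero_iff_of_nonneg (fun ω => sq_nonneg _) hint).1 hzero] with ω hω
  have := pow_eq_zero_iff (two_ne_zero) |>.1 hω
  linarith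

theorem ae_add (hW : IsWhiteGaussianNoise μ Ts v W) (f g : TestFn Ts) :
    W (f + g) =ᵐ[μ] fun ω => W f ω + W g ω := by
  simpa using hW.ae_linear 1 1 f g

theorem ae_smul (hW : IsWhiteGaussianNoise μ Ts v W) (c : ℝ) (f : TestFn Ts) :
    W (c • f) =ᵐ[μ] fun ω => c * W f ω := by
  simpa using hW.ae_linear c 0 f 0

theorem ae_zero (hW : IsWhiteGaussianNoise μ Ts v W) : W 0 =ᵐ[μ] 0 := by
  simpa using! hW.ae_smul 0 0

theorem mgf_eq (hW : IsWhiteGaussianNoise μ Ts v W) (hv : 0 ≤ v) (f : TestFn Ts) (t : ℝ) :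
    mgf (W f) μ t = Real.exp (v * ‖f‖ ^ 2 * t ^ 2 / 2) := by
  have hvar : Var[W f; μ] = v * ‖f‖ ^ 2 := by
    rw [variance_of_integral_eq_zero (hW.measurable f).aemeasurable (hW.mean_zero f),
      ← real_inner_self_eq_norm_sq, ← hW.covariance]
    simp_rw [sq]
  rw [mgf_gaussianReal (hW.gaussian.hasGaussianLaw_eval f).map_eq_gaussianReal, hW.mean_zero, hvar,
    Real.coe_toNNReal _ (by positivity), zero_mul, zero_add]

end IsWhiteGaussianNoise

variable {Ω : Type*} [MeasurableSpace Ω] {μ : Measure Ω} {N : ℕ} {Ts : ℝ} {v : Fin N → ℝ}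
  {η : Fin N → TestFn Ts → Ω → ℝ}

/-- Tuples of test functions, one for every subband, with the `L²` norm. -/
abbrev MultibandTestFn (N : ℕ) (Ts : ℝ) : Type := PiLp 2 fun _ : Fin N => TestFn Ts

/-- The noise of all subbands, normalized to unit variance. -/
noncomputable def whitenedNoise (v : Fin N → ℝ) (η : Fin N → TestFn Ts → Ω → ℝ)
    (F : MultibandTestFn N Ts) (ω : Ω) : ℝ :=
  ∑ i, η i ((√(v i))⁻¹ • F i) ω

theorem isIsonormal_whitenedNoise (hv : ∀ i, 0 < v i)
    (hη : ∀ i, IsWhiteGaussianNoise μ Ts (v i) (η i))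
    (hind : iIndepFun (fun i ω f => η i f ω) μ) : IsIsonormal (whitenedNoise v η) μ where
  measurable F := Finset.measurable_sum _ fun i _ => (hη i).measurable _
  map_eq F := by
    have : IsProbabilityMeasure μ := hind.isProbabilityMeasure
    have hm : Measurable (whitenedNoise v η F) :=
      Finset.measurable_sum _ fun i _ => (hη i).measurable _
    refine map_eq_gaussianReal_of_mgf hm.aemeasurable _ _ fun t => ?_
    -- Independence of the whole processes passes to one coordinate of each.
    have hind' : iIndepFun (fun i => η i ((√(v i))⁻¹ • F i)) μ :=
      hind.comp (fun i (y : TestFn Ts → ℝ) => y ((√(v i))⁻¹ • F i)) fun i => measurable_pi_apply _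
    have hsum : whitenedNoise v η F = ∑ i, η i ((√(v i))⁻¹ • F i) := by
      ext ω; simp [whitenedNoise]
    rw [hsum, hind'.mgf_sum (fun i => (hη i).measurable _)]
    simp_rw [(hη _).mgf_eq (hv _).le]
    rw [← Real.exp_sum]
    congr 1
    simp only [zero_mul, zero_add, NNReal.coe_pow, coe_nnnorm]
    rw [PiLp.norm_sq_eq_of_L2, Finset.sum_mul, Finset.sum_div]
    refine Finset.sum_congr rfl fun i _ => ?_
    rw [norm_smul, mul_pow, norm_inv, inv_pow, Real.norm_eq_abs, sq_abs, Real.sq_sqrt (hv i).le,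
      mul_inv_cancel_left₀ (hv i).ne']
  ae_add F G := by
    have h : ∀ᵐ ω ∂μ, ∀ i, η i ((√(v i))⁻¹ • F i + (√(v i))⁻¹ • G i) ω
        = η i ((√(v i))⁻¹ • F i) ω + η i ((√(v i))⁻¹ • G i) ω :=
      ae_all_iff.2 fun i => (hη i).ae_add _ _
    filter_upwards [h] with ω hω
    simp only [whitenedNoise, PiLp.add_apply, smul_add, hω, Finset.sum_add_distrib]
  ae_smul c F := by
    have h : ∀ᵐ ω ∂μ, ∀ i, η i (c • (√(v i))⁻¹ • F i) ω = c * η i ((√(v i))⁻¹ • F i) ω :=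
      ae_all_iff.2 fun i => (hη i).ae_smul _ _
    filter_upwards [h] with ω hω
    simp only [whitenedNoise, PiLp.smul_apply, smul_comm _ c, hω, Finset.mul_sum]

/-- The test function of a single subband that recovers the noise of this subband from the
whitened noise. -/
noncomputable def subbandTestFn (v : Fin N → ℝ) (p : Fin N × TestFn Ts) : MultibandTestFn N Ts :=
  WithLp.toLp 2 (Pi.single p.1 (√(v p.1) • p.2))

/-- The factor √v undoes the whitening. The other subbands contribute `η i 0`, which vanishes only
almost surely. -/
theorem noise_ae_eq (hv : ∀ i, 0 < v i) (hη : ∀ i, IsWhiteGaussianNoise μ Ts (v i) (η i))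
    (p : Fin N × TestFn Ts) : η p.1 p.2 =ᵐ[μ] whitenedNoise v η (subbandTestFn v p) := by
  have h : ∀ᵐ ω ∂μ, ∀ i, η i 0 ω = 0 := ae_all_iff.2 fun i => (hη i).ae_zero
  filter_upwards [h] with ω hω
  rw [whitenedNoise, Finset.sum_eq_single p.1]
  · have : √(v p.1) ≠ 0 := (Real.sqrt_pos.2 (hv p.1)).ne'
    simp [subbandTestFn, smul_smul, this]
  · intro i _ hi
    simp [subbandTestFn, hi, hω]
  · simp

/-- The signal of all subbands, normalized to unit noise variance. -/
noncomputable def whitenedSignal (v : Fin N → ℝ) (m : Fin N → TestFn Ts) : MultibandTestFn N Ts :=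
  WithLp.toLp 2 fun i => (√(v i))⁻¹ • m i

/-- The two scalings cancel, so a Cameron–Martin shift in whitened coordinates is exactly the change
of the integrated signal. -/
theorem inner_subbandTestFn (hv : ∀ i, 0 < v i) (p : Fin N × TestFn Ts) (m : Fin N → TestFn Ts) :
    ⟪subbandTestFn v p, whitenedSignal v m⟫ = ⟪p.2, m p.1⟫ := by
  rw [PiLp.inner_apply, Finset.sum_eq_single p.1]
  · have : √(v p.1) ≠ 0 := (Real.sqrt_pos.2 (hv p.1)).ne'
    simp [subbandTestFn, whitenedSignal, real_inner_smul_left, real_inner_smul_right, this]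
  · intro i _ hi
    simp [subbandTestFn, hi]
  · simp

theorem norm_sq_whitenedSignal (hv : ∀ i, 0 < v i) (m : Fin N → TestFn Ts) :
    ‖whitenedSignal v m‖ ^ 2 = ∑ i, ‖m i‖ ^ 2 / v i := by
  rw [PiLp.norm_sq_eq_of_L2]
  refine Finset.sum_congr rfl fun i _ => ?_
  simp only [whitenedSignal]
  rw [norm_smul, mul_pow, norm_inv, inv_pow, Real.norm_eq_abs, sq_abs, Real.sq_sqrt (hv i).le,
    inv_mul_eq_div]

theorem hasDerivAt_whitenedSignal {m : ℝ → Fin N → TestFn Ts} {m' : Fin N → TestFn Ts} {θ : ℝ}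
    (hm : ∀ i, HasDerivAt (fun θ => m θ i) (m' i) θ) :
    HasDerivAt (fun θ => whitenedSignal v (m θ)) (whitenedSignal v m') θ := by
  have h : HasDerivAt (fun θ i => (√(v i))⁻¹ • m θ i) (fun i => (√(v i))⁻¹ • m' i) θ :=
    hasDerivAt_pi.2 fun i => (hm i).fun_const_smul _
  exact (PiLp.continuousLinearEquiv 2 ℝ fun _ : Fin N => TestFn Ts).symm.toContinuousLinearMap
    |>.hasFDerivAt.comp_hasDerivAt θ h

/-- The whitened data, centred at the signal `m`. -/
noncomputable def whitenedData (v : Fin N → ℝ) (m : Fin N → TestFn Ts) (F : MultibandTestFn N Ts)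
    (x : Data N Ts) : ℝ :=
  ∑ i, (x i ((√(v i))⁻¹ • F i) - ⟪(√(v i))⁻¹ • F i, m i⟫)

theorem measurable_whitenedData (m : Fin N → TestFn Ts) (F : MultibandTestFn N Ts) :
    Measurable (whitenedData v m F) := by
  unfold whitenedData
  fun_prop

variable {h : Fin N → ℝ → ℝ} {m : ℝ → Fin N → TestFn Ts}

theorem measurable_received (hη : ∀ i f, Measurable (η i f)) (θ : ℝ) :
    Measurable (received Ts h η θ) :=
  measurable_pi_lambda _ fun i => measurable_pi_lambda _ fun f => (hη i f).const_add _

omit [MeasurableSpace Ω] in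
theorem whitenedData_received
    (hm : ∀ θ i f, ⟪f, m θ i⟫ = ∫ t in Set.Icc (0 : ℝ) Ts, f t * h i (t - θ)) (θ : ℝ)
    (F : MultibandTestFn N Ts) (ω : Ω) :
    whitenedData v (m θ) F (received Ts h η θ ω) = whitenedNoise v η F ω := by
  simp [whitenedData, whitenedNoise, received, hm]

/-- The law of the received signal under another delay is a shift of the law under the delay
`τ₀`. -/
theorem receivedLaw_eq_shift (hv : ∀ i, 0 < v i)
    (hη : ∀ i, IsWhiteGaussianNoise μ Ts (v i) (η i))
    (hind : iIndepFun (fun i ω f => η i f ω) μ)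
    (hm : ∀ θ i f, ⟪f, m θ i⟫ = ∫ t in Set.Icc (0 : ℝ) Ts, f t * h i (t - θ)) (τ₀ θ : ℝ) :
    receivedLaw μ Ts h η θ = IsIsonormal.shift (whitenedData v (m τ₀)) (receivedLaw μ Ts h η τ₀)
      (whitenedSignal v (m θ) - whitenedSignal v (m τ₀)) := by
  have hW := isIsonormal_whitenedNoise hv hη hind
  have hmeas : ∀ i f, Measurable (η i f) := fun i => (hη i).measurable
  set G := whitenedSignal v (m θ) - whitenedSignal v (m τ₀)
  -- T adds the signal for delay τ₀ and curries the index pair: it carries the noise to the data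
  -- under τ₀, and the shifted noise to the data under θ.
  set T : (Fin N × TestFn Ts → ℝ) → Data N Ts := fun y i f => ⟪f, m τ₀ i⟫ + y (i, f)
  have hT : Measurable T := by
    refine measurable_pi_lambda _ fun i => measurable_pi_lambda _ fun f => ?_
    exact (measurable_pi_apply (i, f)).const_add _
  have h1 := hW.map_process_shift (subbandTestFn v) (fun p => η p.1 p.2) (fun p => hmeas _ _)
    (noise_ae_eq hv hη) G
  have h2 := congrArg (Measure.map T) h1
  rw [Measure.map_map hT (measurable_pi_lambda _ fun p => hmeas _ _),
    Measure.map_map hT (measurable_pi_lambda _ fun p => (hmeas _ _).add_const _)] at h2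
  have e1 : (T ∘ fun ω (p : Fin N × TestFn Ts) => η p.1 p.2 ω) = received Ts h η τ₀ := by
    ext ω i f
    simp [T, received, hm]
  have e2 : (T ∘ fun ω (p : Fin N × TestFn Ts) => η p.1 p.2 ω + ⟪subbandTestFn v p, G⟫)
      = received Ts h η θ := by
    ext ω i f
    simp only [Function.comp_apply, T, G, inner_sub_right, inner_subbandTestFn hv, received, hm]
    ring
  rw [e1, e2, IsIsonormal.map_shift_eq (measurable_received hmeas τ₀)
    (measurable_whitenedData (m τ₀)) (whitenedData_received hm τ₀)] at h2
  exact h2.symm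

end CognitiveRadar

/-! ### The delay-estimation bound -/

theorem mainTheorem1
    {Ω : Type*} [MeasurableSpace Ω] (μ : Measure Ω) [IsProbabilityMeasure μ]
    (Nb : ℕ) (hNb : 1 ≤ Nb)
    (Ts w : ℝ) (hw : 0 < w) (hwTs : w < Ts)
    (N₀ : ℝ) (hN₀ : 0 < N₀) (B : Fin Nb → ℝ) (hB : ∀ i, 0 < B i)
    (h : Fin Nb → ℝ → ℝ) (h_smooth : ∀ i, ContDiff ℝ 2 (h i))
    (h_supp : ∀ i, ∀ t, t ∉ Set.Icc 0 w → h i t = 0) (h_ne : ∀ i, h i ≠ 0)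
    (η : Fin Nb → CognitiveRadar.TestFn Ts → Ω → ℝ)
    (hη : ∀ i, CognitiveRadar.IsWhiteGaussianNoise μ Ts
      (CognitiveRadar.noiseVar N₀ (B i)) (η i))
    (hη_indep : iIndepFun (fun i ω f => η i f ω) μ)
    (τ₀ : ℝ) (hτ₀ : τ₀ ∈ Set.Icc 0 (Ts - w)) :
    IsCramerRaoLowerBound (CognitiveRadar.receivedLaw μ Ts h η) τ₀
      (1 / ∑ i, CognitiveRadar.snr N₀ (B i) (h i) * CognitiveRadar.rmsBandwidth Ts (h i) ^ 2) ∧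
    ∀ est : CognitiveRadar.Data Nb Ts → ℝ,
      IsUnbiasedEstimator (CognitiveRadar.receivedLaw μ Ts h η) (Set.Icc 0 (Ts - w)) est →
      ENNReal.ofReal
        (1 / ∑ i, CognitiveRadar.snr N₀ (B i) (h i) * CognitiveRadar.rmsBandwidth Ts (h i) ^ 2)
        ≤ eVar[est; CognitiveRadar.receivedLaw μ Ts h η τ₀] := by
  have hv : ∀ i, 0 < CognitiveRadar.noiseVar N₀ (B i) := fun i => mul_pos hN₀ (hB i)
  have hc : ∀ i, HasCompactSupport (h i) := fun i =>
    CognitiveRadar.hasCompactSupport_of_support (h_supp i)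
  have h1 : ∀ i, ContDiff ℝ 1 (h i) := fun i => (h_smooth i).of_le one_le_two
  have h1' : ∀ i, ContDiff ℝ 1 (deriv (h i)) := fun i =>
    ((contDiff_succ_iff_deriv (n := 1)).1 (h_smooth i)).2.2
  set v : Fin Nb → ℝ := fun i => CognitiveRadar.noiseVar N₀ (B i)
  set m : ℝ → Fin Nb → CognitiveRadar.TestFn Ts := fun θ i =>
    CognitiveRadar.translate Ts (h1 i).continuous (hc i) θ
  set m' : ℝ → Fin Nb → CognitiveRadar.TestFn Ts := fun θ i =>
    -CognitiveRadar.translate Ts (h1' i).continuous (hc i).deriv θ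
  set m'' : ℝ → Fin Nb → CognitiveRadar.TestFn Ts := fun θ i =>
    CognitiveRadar.translate Ts ((h1' i).continuous_deriv le_rfl) (hc i).deriv.deriv θ
  have hm : ∀ θ i f, ⟪f, m θ i⟫ = ∫ t in Set.Icc (0 : ℝ) Ts, f t * h i (t - θ) :=
    fun θ i f => CognitiveRadar.inner_translate _ _ θ f
  have hM : ∀ θ, HasDerivAt (fun θ => CognitiveRadar.whitenedSignal v (m θ))
      (CognitiveRadar.whitenedSignal v (m' θ)) θ := fun θ =>
    CognitiveRadar.hasDerivAt_whitenedSignal fun i =>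
      CognitiveRadar.hasDerivAt_translate (h1 i) (hc i) θ
  have hM' : HasDerivAt (fun θ => CognitiveRadar.whitenedSignal v (m' θ))
      (CognitiveRadar.whitenedSignal v (m'' τ₀)) τ₀ :=
    CognitiveRadar.hasDerivAt_whitenedSignal fun i =>
      (CognitiveRadar.hasDerivAt_translate (h1' i) (hc i).deriv τ₀).fun_neg.congr_deriv
        (neg_neg _)
  have hW : IsIsonormal (CognitiveRadar.whitenedData v (m τ₀))
      (CognitiveRadar.receivedLaw μ Ts h η τ₀) := (CognitiveRadar.isIsonormal_whitenedNoise hv hη hη_indep).map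
    (CognitiveRadar.measurable_received (h := h) (fun i => (hη i).measurable) τ₀)
    (CognitiveRadar.measurable_whitenedData (m τ₀)) (CognitiveRadar.whitenedData_received hm τ₀)
  have hP := CognitiveRadar.receivedLaw_eq_shift hv hη hη_indep hm τ₀
  have hinfo : ‖CognitiveRadar.whitenedSignal v (m' τ₀)‖ ^ 2 = ∑ i,
      CognitiveRadar.snr N₀ (B i) (h i) * CognitiveRadar.rmsBandwidth Ts (h i) ^ 2 := by
    rw [CognitiveRadar.norm_sq_whitenedSignal hv]
    refine Finset.sum_congr rfl fun i _ => ?_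
    rw [CognitiveRadar.snr_mul_rmsBandwidth_sq (h_smooth i) (h_supp i) (h_ne i) hw.le hwTs.le,
      norm_neg, CognitiveRadar.norm_sq_translate]
    rw [CognitiveRadar.setIntegral_translate (w := w) (f := fun t => deriv (h i) t ^ 2)
      (fun t ht => by
        simp [CognitiveRadar.deriv_eq_zero_of_support (h_supp i) t ht]) hτ₀]
  have hpos : 0 < ∑ i,
      CognitiveRadar.snr N₀ (B i) (h i) * CognitiveRadar.rmsBandwidth Ts (h i) ^ 2 := by
    refine Finset.sum_pos (fun i _ => ?_) ⟨⟨0, hNb⟩, Finset.mem_univ _⟩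
    rw [CognitiveRadar.snr_mul_rmsBandwidth_sq (h_smooth i) (h_supp i) (h_ne i) hw.le hwTs.le]
    refine div_pos (CognitiveRadar.integral_sq_pos (h1' i).continuous (hc i).deriv ?_) (hv i)
    exact CognitiveRadar.deriv_ne_zero_of_hasCompactSupport ((h1 i).differentiable one_ne_zero)
      (hc i) (h_ne i)
  rw [← hinfo] at hpos ⊢
  have hfisher := hW.hasFisherInformation (P := CognitiveRadar.receivedLaw μ Ts h η)
    (M := fun θ => CognitiveRadar.whitenedSignal v (m θ))
    (M' := fun θ => CognitiveRadar.whitenedSignal v (m' θ)) hP hM hM'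
  have hne : CognitiveRadar.whitenedSignal v (m' τ₀) ≠ 0 := fun h0 => by simp [h0] at hpos
  -- Since w < Ts the delay interval is nondegenerate, so each of its points, endpoints included, is
  -- a limit of other admissible delays.
  have hacc : AccPt τ₀ (𝓟 (Set.Icc 0 (Ts - w))) :=
    isPreconnected_Icc.preperfect_of_nontrivial
      ⟨0, Set.left_mem_Icc.2 (sub_pos.2 hwTs).le, Ts - w, Set.right_mem_Icc.2 (sub_pos.2 hwTs).le,
        (sub_pos.2 hwTs).ne⟩ τ₀ hτ₀
  refine ⟨⟨_, hpos, hfisher, rfl⟩, fun est hest => ?_⟩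
  exact hW.cramerRao_le_evariance (P := CognitiveRadar.receivedLaw μ Ts h η)
    (M := fun θ => CognitiveRadar.whitenedSignal v (m θ)) hP (hM τ₀) hne hτ₀ hacc hest
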